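/- Let $G$ be a discrete group and let $\omega$ be a weight on $G$, i.e. a function $\omega:G\to[0,\infty)$ with $\omega(e)=1$, $\omega(x)=\omega(x^{-1})$ and $\omega(xy)\le\omega(x)\omega(y)$ for all $x,y\in G$. Let $1\le p<\infty$, and let $1<q\le\infty$ be the conjugate index, $1/p+1/q=1$. Let $\ell^p(G,\omega)$ be the space of all $f:G\to\mathbb{C}$ with $f\omega\in\ell^p(G)$, with the norm $\|f\|_{p,\omega}=\|f\omega\|_p$. Let $C^*_r(G)$ be the reduced $C^*$-algebra of $G$, i.e. the norm-closed $*$-subalgebra of $B(\ell^2(G))$ generated by the left translations $(\lambda(g)\xi)(x)=\xi(g^{-1}x)$. Suppose that there exist a bounded function $u:G\to[0,\infty)$ and real numbers $s<q$ and $r>0$ such that $\sigma=\omega u$ is bounded away from zero, $$\frac{\omega(xy)}{\omega(x)\omega(y)}\le u(x)+u(y)\quad(x,y\in G),\qquad\text{and}\qquad \sum_{x\in G}u(x)^s\omega(x)^r<\infty .$$ Then the following hold. 1. $\ell^p(G,\omega)$ is a unital Banach $*$-algebra with the convolution $(f*g)(x)=\sum_{y\in G}f(y)g(y^{-1}x)$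 (the sums converging absolutely), the involution $f^*(x)=\overline{f(x^{-1})}$ and the unit $\delta_e$. Here the norm is understood up to a constant factor: for some $K>0$ the norm $K\|\cdot\|_{p,\omega}$ is complete and submultiplicative, and $\|f^*\|_{p,\omega}=\|f\|_{p,\omega}$. 2. Letting $f\in\ell^p(G,\omega)$ act on $\ell^2(G)$ by left convolution, $\xi\mapsto f*\xi$, defines an injective unital $*$-homomorphism of $\ell^p(G,\omega)$ into $C^*_r(G)$. The algebra $\ell^p(G,\omega)$, regarded as a subalgebra, is inverse-closed in $C^*_r(G)$: every $f\in\ell^p(G,\omega)$ that is invertible in $C^*_r(G)$ has its inverse in $\ell^p(G,\omega)$. 3. $\ell^p(G,\omega)$ admits norm-controlled inversion in $C^*_r(G)$: there is a function $h:[0,\infty)\times[0,\infty)\to[0,\infty)$ such that for every invertible $f\in\ell^p(G,\omega)$ $$\|f^{-1}\|_{p,\omega}\le h\big(\|f\|_{p,\omega},\ \|f^{-1}\|_{C^*_r(G)}\big).$$ In particular, 1–3 hold whenever $\omega$ is weakly subadditive, i.e. $\omega(xy)\le D(\omega(x)+\omega(y))$ for all $x,y\in G$ with some constant $D>0$, and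 $\omega^{-1}\in\ell^s(G)$ for some real $0<s<q$. -/

import Mathlib

open scoped ENNReal

universe u

/-- A weight on a (discrete) group: a function `ω : G → [0, ∞)` which is normalized, symmetric and
submultiplicative. -/
structure Weight (G : Type u) [Group G] where
  toFun : G → ℝ
  nonneg : ∀ x, 0 ≤ toFun x
  map_one : toFun 1 = 1
  map_inv : ∀ x, toFun x⁻¹ = toFun x
  map_mul_le : ∀ x y, toFun (x * y) ≤ toFun x * toFun y

instance Weight.instCoeFun (G : Type u) [Group G] : CoeFun (Weight G) (fun _ => G → ℝ) :=
  ⟨Weight.toFun⟩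

section WeightedSpace

variable {G : Type u} [Group G]

/-- The weighted space `ℓ^p(G, ω)` of all `f : G → ℂ` with `f ω ∈ ℓ^p(G)`. -/
def weightedLp (p : ℝ≥0∞) (ω : Weight G) : Submodule ℂ (G → ℂ) where
  carrier := {f | Memℓp (fun x => f x * (ω x : ℂ)) p}
  add_mem' {f g} hf hg := by
    have h : Memℓp ((fun x => f x * (ω x : ℂ)) + fun x => g x * (ω x : ℂ)) p := Memℓp.add hf hg
    have e : (fun x => (f + g) x * (ω x : ℂ)) =
        (fun x => f x * (ω x : ℂ)) + fun x => g x * (ω x : ℂ) := by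
      funext x; simp [add_mul]
    show Memℓp (fun x => (f + g) x * (ω x : ℂ)) p
    rw [e]; exact h
  zero_mem' := by
    have h : Memℓp (0 : G → ℂ) p := zero_memℓp
    have e : (fun x => (0 : G → ℂ) x * (ω x : ℂ)) = 0 := by
      funext x; simp
    show Memℓp (fun x => (0 : G → ℂ) x * (ω x : ℂ)) p
    rw [e]; exact h
  smul_mem' c f hf := by
    have h : Memℓp (c • fun x => f x * (ω x : ℂ)) p := Memℓp.const_smul hf c
    have e : (fun x => (c • f) x * (ω x : ℂ)) = c • fun x => f x * (ω x : ℂ) := by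
      funext x; simp [mul_assoc]
    show Memℓp (fun x => (c • f) x * (ω x : ℂ)) p
    rw [e]; exact h

/-- The norm `‖f‖_{p,ω} = ‖f ω‖_p` of `ℓ^p(G, ω)`. -/
noncomputable def weightedNorm (p : ℝ≥0∞) (ω : Weight G) (f : weightedLp p ω) : ℝ :=
  ‖(⟨fun x => f.1 x * (ω x : ℂ), f.2⟩ : lp (fun _ : G => ℂ) p)‖

end WeightedSpace

section ReducedGroupCStarAlgebra

variable (G : Type u) [Group G]

/-- The Hilbert space `ℓ²(G)`. -/
abbrev EllTwo : Type u := lp (fun _ : G => ℂ) 2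

variable {G}

/-- The left regular representation, `(λ(g) ξ)(x) = ξ(g⁻¹ x)`. -/
noncomputable def leftRegular (g : G) : EllTwo G →L[ℂ] EllTwo G :=
  LinearMap.mkContinuous
    { toFun := fun ξ => ⟨fun x => ξ (g⁻¹ * x), by
        have h := (memℓp_gen_iff (p := 2) (by norm_num)).1 (lp.memℓp ξ)
        exact (memℓp_gen_iff (p := 2) (by norm_num)).2
          ((Equiv.mulLeft g⁻¹).summable_iff.2 h)⟩
      map_add' := fun ξ η => by ext x; rfl
      map_smul' := fun c ξ => by ext x; rfl } 1
    (fun ξ => by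
      rw [one_mul, lp.norm_eq_tsum_rpow (p := 2) (by norm_num),
        lp.norm_eq_tsum_rpow (p := 2) (by norm_num)]
      exact le_of_eq (congrArg (fun t : ℝ => t ^ (1 / (2 : ℝ≥0∞).toReal))
        ((Equiv.mulLeft g⁻¹).tsum_eq (fun x => ‖ξ x‖ ^ (2 : ℝ≥0∞).toReal))))

variable (G)

/-- The reduced group C*-algebra `C*_r(G)`: the norm closure, in the bounded operators on `ℓ²(G)`,
of the *-algebra generated by the left regular representation. -/
noncomputable def reducedGroupCStarAlgebra : StarSubalgebra ℂ (EllTwo G →L[ℂ] EllTwo G) :=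
  (StarAlgebra.adjoin ℂ (Set.range (leftRegular (G := G)))).topologicalClosure

end ReducedGroupCStarAlgebra

/-- A unital subalgebra `φ : A → B` is inverse-closed if every element of `A` that is invertible in
`B` is invertible in `A`. -/
def InverseClosed {A B : Type*} [Ring A] [StarRing A] [Algebra ℂ A] [Ring B] [StarRing B]
    [Algebra ℂ B] (φ : A →⋆ₐ[ℂ] B) : Prop :=
  ∀ a : A, IsUnit (φ a) → IsUnit a

/-- Norm-controlled inversion of the subalgebra `φ : A → B`, where `A` carries the norm `N`:
`N(a⁻¹) ≤ h(N(a), ‖a⁻¹‖_B)` for all invertible `a`, with a function `h` that does not depend on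
`a`. It is used for an inverse-closed subalgebra, where invertibility in `A` and in `B` agree. -/
def AdmitsNormControlledInversion {A B : Type*} [Ring A] [StarRing A] [Algebra ℂ A]
    [NormedRing B] [StarRing B] [Algebra ℂ B] (N : A → ℝ) (φ : A →⋆ₐ[ℂ] B) : Prop :=
  ∃ h : ℝ → ℝ → ℝ, (∀ s t, 0 ≤ s → 0 ≤ t → 0 ≤ h s t) ∧
    ∀ a : Aˣ, N (↑a⁻¹ : A) ≤ h (N (a : A)) ‖φ (↑a⁻¹ : A)‖

section Model

variable {G : Type u} [Group G]

/-- The unital Banach *-algebra `A` is, through the linear bijection `e`, the space `ℓ^p(G, ω)` with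
the convolution product `(f * g)(x) = ∑ y, f y * g (y⁻¹ x)` (the sums converge absolutely), the
involution `f^*(x) = conj (f x⁻¹)`, the unit `δ_1`, and a constant multiple of `‖·‖_{p,ω}` as its
submultiplicative norm. -/
structure IsWeightedConvolutionAlgebra (p : ℝ≥0∞) (ω : Weight G) {A : Type u} [NormedRing A]
    [NormedAlgebra ℂ A] [StarRing A] (e : A ≃ₗ[ℂ] weightedLp p ω) : Prop where
  norm_eq : ∃ K : ℝ, 0 < K ∧ ∀ a, ‖a‖ = K * weightedNorm p ω (e a)
  mul_apply : ∀ a b x, HasSum (fun y => (e a).1 y * (e b).1 (y⁻¹ * x)) ((e (a * b)).1 x)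
  star_apply : ∀ a x, (e (star a)).1 x = (starRingEnd ℂ) ((e a).1 x⁻¹)
  one_apply_one : (e 1).1 1 = 1
  one_apply_of_ne : ∀ x, x ≠ 1 → (e 1).1 x = 0
  norm_star : ∀ a, weightedNorm p ω (e (star a)) = weightedNorm p ω (e a)

/-- `ℓ^p(G, ω)` is a Banach *-algebra under convolution, it is contained in `C*_r(G)` (a function
acting on `ℓ²(G)` by left convolution), it is inverse-closed there, and it admits norm-controlled
inversion there with respect to the norm `‖·‖_{p,ω}`. -/
def HasNormControlledInversionInReduced (p : ℝ≥0∞) (ω : Weight G) : Prop :=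
  ∃ (A : Type u) (_ : NormedRing A) (_ : NormedAlgebra ℂ A) (_ : StarRing A) (_ : StarModule ℂ A)
    (_ : NormedStarGroup A) (_ : CompleteSpace A) (e : A ≃ₗ[ℂ] weightedLp p ω)
    (Φ : A →⋆ₐ[ℂ] reducedGroupCStarAlgebra G),
    IsWeightedConvolutionAlgebra p ω e ∧
    Function.Injective Φ ∧
    (∀ (a : A) (ξ : EllTwo G) (x : G),
      HasSum (fun y => (e a).1 y * ξ (y⁻¹ * x))
        (((Φ a : EllTwo G →L[ℂ] EllTwo G) ξ : EllTwo G) x)) ∧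
    InverseClosed Φ ∧
    AdmitsNormControlledInversion (fun a => weightedNorm p ω (e a)) Φ

end Model

/-! The function `u` sharpens submultiplicativity to ω(xy) ≤ ω(x)ω(y)(u(x)+u(y)). Hence, by
Minkowski, ‖f*g‖ ≤ ‖fωu‖₁‖g‖ + ‖f‖‖gωu‖₁ in the weighted norm (`conv_spec`). Splitting |f|ωu =
(|f|ω)^(1-θ) · |f|^θ · uω^θ, Hölder's inequality gives ‖fωu‖₁ ≤ C‖f‖^(1-θ)‖f‖_∞^θ for a suitable
small θ (`summable_size_and_le`); s < q and r > 0 are what make such a θ available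
(`exists_conjugate_exponents`). Since f = f*δ_e, also ‖f‖_∞ ≤ ‖λ(f)‖, so ‖f*f‖ ≤ C'‖f‖^(2-θ)‖λ(f)‖^θ
(`norm_mul_self_le`).

Such a differential inequality forces norm-controlled inversion. For a suitable R, the element b = 1
- R⁻¹a*a has operator norm at most some ρ < 1. Under repeated squaring the Banach norm grows with
exponent 2-θ < 2, which the factor ρ^(2^n) outruns. So ‖b^(2^k)‖ ≤ 1/2 for a k depending only on the
two given norms, and a Neumann series yields a left inverse of a with a uniform bound. -/

/-! ### Weights and control functions -/

theorem Weight.one_le {G : Type u} [Group G] (ω : Weight G) (x : G) : 1 ≤ ω x := by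
  have h := ω.map_mul_le x x⁻¹
  rw [mul_inv_cancel, ω.map_one, ω.map_inv] at h
  nlinarith [ω.nonneg x]

theorem Weight.pos {G : Type u} [Group G] (ω : Weight G) (x : G) : 0 < ω x :=
  one_pos.trans_le (ω.one_le x)

/-- A function `u` controlling the weight `ω`, with the exponents `θ` and `t` for which the
functional `f ↦ ∑ |f| ω u` on `ℓ^p(G, ω)` is dominated by `‖f‖_{p,ω}^{1-θ} ‖f‖_∞^θ`. -/
structure ControlFunction {G : Type u} [Group G] (p : ℝ≥0∞) (ω : Weight G) where
  toFun : G → ℝ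
  θ : ℝ
  t : ℝ
  δ : ℝ
  one_le : 1 ≤ p
  ne_top : p ≠ ∞
  nonneg : ∀ x, 0 ≤ toFun x
  θ_pos : 0 < θ
  θ_lt_one : θ < 1
  conj : (p.toReal / (1 - θ)).HolderConjugate t
  δ_pos : 0 < δ
  le_mul : ∀ x, δ ≤ ω x * toFun x
  map_mul_le : ∀ x y, ω (x * y) ≤ ω x * ω y * (toFun x + toFun y)
  summable : Summable fun x => (toFun x * ω x ^ θ) ^ t

/-! ### Rearrangements in ℓ^p -/

section Translation

variable {ι : Type*} {p : ℝ≥0∞}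

theorem Memℓp.comp_equiv {E : Type*} [NormedAddCommGroup E] (hp : 0 < p.toReal)
    (σ : Equiv.Perm ι) {f : ι → E} (hf : Memℓp f p) : Memℓp (f ∘ σ) p :=
  (memℓp_gen_iff hp).2 (σ.summable_iff.2 ((memℓp_gen_iff hp).1 hf))

theorem lp.norm_comp_equiv {E : Type*} [NormedAddCommGroup E] (hp : 0 < p.toReal)
    (σ : Equiv.Perm ι) (f : lp (fun _ : ι => E) p) :
    ‖(⟨f ∘ σ, (lp.memℓp f).comp_equiv hp σ⟩ : lp (fun _ : ι => E) p)‖ = ‖f‖ := by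
  rw [lp.norm_eq_tsum_rpow hp, lp.norm_eq_tsum_rpow hp]
  exact congrArg (fun t : ℝ => t ^ (1 / p.toReal)) (σ.tsum_eq fun x => ‖f x‖ ^ p.toReal)

/-- Averages of rearrangements of an `ℓ^p` function against a summable sequence. -/
theorem lp.exists_hasSum_mul_comp_equiv {κ : Type*} [Fact (1 ≤ p)] (hp : p ≠ ∞)
    (σ : κ → Equiv.Perm ι)
    {a : κ → ℝ} (ha0 : ∀ y, 0 ≤ a y) (ha : Summable a) (F : lp (fun _ : ι => ℝ) p) :
    ∃ H : lp (fun _ : ι => ℝ) p, ‖H‖ ≤ (∑' y, a y) * ‖F‖ ∧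
      ∀ x, HasSum (fun y => a y * F (σ y x)) (H x) := by
  have hp0 : 0 < p.toReal :=
    ENNReal.toReal_pos (zero_lt_one.trans_le Fact.out).ne' hp
  let L : κ → lp (fun _ : ι => ℝ) p := fun y => ⟨F ∘ σ y, (lp.memℓp F).comp_equiv hp0 (σ y)⟩
  have hL : ∀ y, ‖a y • L y‖ = a y * ‖F‖ := fun y => by
    rw [norm_smul, Real.norm_of_nonneg (ha0 y), lp.norm_comp_equiv hp0]
  have hs : Summable fun y => ‖a y • L y‖ := by
    simp only [hL]; exact ha.mul_right _
  refine ⟨∑' y, a y • L y, ?_, fun x => ?_⟩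
  · refine (norm_tsum_le_tsum_norm hs).trans_eq ?_
    simp only [hL]; exact tsum_mul_right
  · exact (lp.evalCLM ℝ (fun _ : ι => ℝ) p x).hasSum hs.of_norm.hasSum

end Translation

/-! ### The functional ‖fωu‖₁ and the product estimate -/

namespace ControlFunction

variable {G : Type u} [Group G] {p : ℝ≥0∞} {ω : Weight G} (U : ControlFunction p ω)

include U in
theorem toReal_pos : 0 < p.toReal :=
  ENNReal.toReal_pos (zero_lt_one.trans_le U.one_le).ne' U.ne_top

/-- The functional `∑ |f| ω u`. -/
noncomputable def size (f : weightedLp p ω) : ℝ := ∑' x, ‖f.1 x‖ * ω x * U.toFun x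

/-- The constant `‖u ω^θ‖_t`. -/
noncomputable def const : ℝ := (∑' x, (U.toFun x * ω x ^ U.θ) ^ U.t) ^ (1 / U.t)

theorem base_nonneg (x : G) : 0 ≤ U.toFun x * ω x ^ U.θ :=
  mul_nonneg (U.nonneg x) (Real.rpow_nonneg (ω.nonneg x) _)

theorem const_nonneg : 0 ≤ U.const :=
  Real.rpow_nonneg (tsum_nonneg fun x => Real.rpow_nonneg (U.base_nonneg x) _) _

end ControlFunction

section

variable {G : Type u} [Group G] {p : ℝ≥0∞} {ω : Weight G}

theorem weightedNorm_nonneg (f : weightedLp p ω) : 0 ≤ weightedNorm p ω f := lp.norm_nonneg' _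

theorem norm_mul_weight (f : G → ℂ) (x : G) : ‖f x * (ω x : ℂ)‖ = ‖f x‖ * ω x := by
  rw [norm_mul, Complex.norm_real, Real.norm_of_nonneg (ω.nonneg x)]

theorem hasSum_weightedNorm (hp : 0 < p.toReal) (f : weightedLp p ω) :
    HasSum (fun x => (‖f.1 x‖ * ω x) ^ p.toReal) (weightedNorm p ω f ^ p.toReal) := by
  have h := lp.hasSum_norm hp (⟨fun x => f.1 x * (ω x : ℂ), f.2⟩ : lp (fun _ : G => ℂ) p)
  simp only [norm_mul_weight] at h
  exact h

theorem norm_mul_weight_le (hp : p ≠ 0) (f : weightedLp p ω) (x : G) :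
    ‖f.1 x‖ * ω x ≤ weightedNorm p ω f := by
  rw [← norm_mul_weight]
  exact lp.norm_apply_le_norm hp
    (⟨fun x => f.1 x * (ω x : ℂ), f.2⟩ : lp (fun _ : G => ℂ) p) x

theorem norm_apply_le_weightedNorm (hp : p ≠ 0) (f : weightedLp p ω) (x : G) :
    ‖f.1 x‖ ≤ weightedNorm p ω f :=
  (le_mul_of_one_le_right (norm_nonneg _) (ω.one_le x)).trans (norm_mul_weight_le hp f x)

namespace ControlFunction

variable (U : ControlFunction p ω)

include U in
theorem ne_zero : p ≠ 0 := (zero_lt_one.trans_le U.one_le).ne'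

/-- Hölder with exponents p/(1-θ) and t, applied to (|f|ω)^(1-θ) and uω^θ; the remaining factor
|f|^θ is bounded by B^θ. Keeping B free allows both the weighted norm and the operator norm as a
bound for the sup norm. -/
theorem summable_size_and_le (f : weightedLp p ω) {B : ℝ} (hB : ∀ x, ‖f.1 x‖ ≤ B) :
    (Summable fun x => ‖f.1 x‖ * ω x * U.toFun x) ∧
      U.size f ≤ U.const * weightedNorm p ω f ^ (1 - U.θ) * B ^ U.θ := by
  have hθ : 0 < 1 - U.θ := sub_pos.2 U.θ_lt_one
  have hB0 : 0 ≤ B := (norm_nonneg _).trans (hB 1)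
  have hF : ∀ x, 0 ≤ ‖f.1 x‖ * ω x := fun x => mul_nonneg (norm_nonneg _) (ω.nonneg x)
  have hN := weightedNorm_nonneg f
  have hT : 0 ≤ ∑' x, (U.toFun x * ω x ^ U.θ) ^ U.t :=
    tsum_nonneg fun x => Real.rpow_nonneg (U.base_nonneg x) _
  obtain ⟨C, hC0, hC, hsum⟩ := Real.inner_le_Lp_mul_Lq_hasSum_of_nonneg U.conj
    (f := fun x => (‖f.1 x‖ * ω x) ^ (1 - U.θ)) (g := fun x => U.toFun x * ω x ^ U.θ)
    (A := weightedNorm p ω f ^ (1 - U.θ)) (B := U.const)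
    (Real.rpow_nonneg hN _) U.const_nonneg (fun x => Real.rpow_nonneg (hF x) _) U.base_nonneg
    (by
      have e : (1 - U.θ) * (p.toReal / (1 - U.θ)) = p.toReal := by field_simp
      simp only [← Real.rpow_mul hN, ← Real.rpow_mul (hF _), e]
      exact hasSum_weightedNorm U.toReal_pos f)
    (by
      rw [const, ← Real.rpow_mul hT, one_div_mul_cancel U.conj.symm.ne_zero, Real.rpow_one]
      exact U.summable.hasSum)
  have hle : ∀ x, ‖f.1 x‖ * ω x * U.toFun x ≤
      B ^ U.θ * ((‖f.1 x‖ * ω x) ^ (1 - U.θ) * (U.toFun x * ω x ^ U.θ)) := fun x => by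
    have h1 : ‖f.1 x‖ * ω x = (‖f.1 x‖ * ω x) ^ (1 - U.θ) * (‖f.1 x‖ ^ U.θ * ω x ^ U.θ) := by
      rw [← Real.mul_rpow (norm_nonneg _) (ω.nonneg x), ← Real.rpow_add_of_nonneg (hF x) hθ.le
        U.θ_pos.le, sub_add_cancel, Real.rpow_one]
    have h2 : ‖f.1 x‖ ^ U.θ ≤ B ^ U.θ := Real.rpow_le_rpow (norm_nonneg _) (hB x) U.θ_pos.le
    have h3 : 0 ≤ (‖f.1 x‖ * ω x) ^ (1 - U.θ) := Real.rpow_nonneg (hF x) _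
    calc ‖f.1 x‖ * ω x * U.toFun x
        = ‖f.1 x‖ ^ U.θ * ((‖f.1 x‖ * ω x) ^ (1 - U.θ) * (U.toFun x * ω x ^ U.θ)) := by
          conv_lhs => rw [h1]
          ring
      _ ≤ _ := mul_le_mul_of_nonneg_right h2 (mul_nonneg h3 (U.base_nonneg x))
  have hs := Summable.of_nonneg_of_le (fun x => mul_nonneg (hF x) (U.nonneg x)) hle
    (hsum.summable.mul_left _)
  refine ⟨hs, ?_⟩
  calc U.size f ≤ ∑' x, B ^ U.θ * ((‖f.1 x‖ * ω x) ^ (1 - U.θ) * (U.toFun x * ω x ^ U.θ)) :=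
        hs.tsum_le_tsum hle (hsum.summable.mul_left _)
    _ = B ^ U.θ * C := (hsum.mul_left _).tsum_eq
    _ ≤ B ^ U.θ * (weightedNorm p ω f ^ (1 - U.θ) * U.const) :=
        mul_le_mul_of_nonneg_left hC (Real.rpow_nonneg hB0 _)
    _ = _ := by ring

theorem summable_size (f : weightedLp p ω) :
    Summable fun x => ‖f.1 x‖ * ω x * U.toFun x :=
  (U.summable_size_and_le f (norm_apply_le_weightedNorm U.ne_zero f)).1

theorem size_le (f : weightedLp p ω) : U.size f ≤ U.const * weightedNorm p ω f := by
  refine (U.summable_size_and_le f (norm_apply_le_weightedNorm U.ne_zero f)).2.trans_eq ?_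
  rw [mul_assoc, ← Real.rpow_add_of_nonneg (weightedNorm_nonneg f)
    (sub_pos.2 U.θ_lt_one).le U.θ_pos.le, sub_add_cancel, Real.rpow_one]

/-- This is where ωu being bounded away from zero enters: it turns control of ‖fωu‖₁ into control of
‖f‖₁. -/
theorem norm_le_inv_mul (f : weightedLp p ω) (x : G) :
    ‖f.1 x‖ ≤ U.δ⁻¹ * (‖f.1 x‖ * ω x * U.toFun x) := by
  rw [inv_mul_eq_div, le_div_iff₀ U.δ_pos, mul_assoc]
  exact mul_le_mul_of_nonneg_left (U.le_mul x) (norm_nonneg _)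

include U in
/-- `ℓ^p(G, ω)` is contained in `ℓ¹(G)`. -/
theorem summable_norm (f : weightedLp p ω) : Summable fun x => ‖f.1 x‖ :=
  Summable.of_nonneg_of_le (fun _ => norm_nonneg _) (U.norm_le_inv_mul f)
    ((U.summable_size f).mul_left U.δ⁻¹)

/-- The convolution product. -/
noncomputable def conv (f g : G → ℂ) (x : G) : ℂ := ∑' y, f y * g (y⁻¹ * x)

/-- Pointwise, |f*g|ω is at most (|f|ωu)*(|g|ω) + (|f|ω)*(|g|ωu). Each term is an ℓ¹ average of
translates of an ℓ^p function, left translates in the first and right translates in the second. -/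
theorem conv_spec (f g : weightedLp p ω) :
    (∀ x, HasSum (fun y => f.1 y * g.1 (y⁻¹ * x)) (conv f.1 g.1 x)) ∧
      ∃ h : conv f.1 g.1 ∈ weightedLp p ω,
        weightedNorm p ω ⟨conv f.1 g.1, h⟩ ≤
          U.size f * weightedNorm p ω g + weightedNorm p ω f * U.size g := by
  have : Fact (1 ≤ p) := ⟨U.one_le⟩
  have hp := U.toReal_pos
  let T : weightedLp p ω → lp (fun _ : G => ℂ) p := fun f => ⟨fun x => f.1 x * (ω x : ℂ), f.2⟩
  have hT : ∀ f x, lp.toNorm (T f) x = ‖f.1 x‖ * ω x := fun f x => norm_mul_weight _ _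
  have hTn : ∀ f, ‖lp.toNorm (T f)‖ = weightedNorm p ω f := fun f => lp.norm_toNorm
  have hpos : ∀ (f : weightedLp p ω) x, 0 ≤ ‖f.1 x‖ * ω x * U.toFun x := fun f x =>
    mul_nonneg (mul_nonneg (norm_nonneg _) (ω.nonneg x)) (U.nonneg x)
  obtain ⟨H₁, hH₁, hs₁⟩ := lp.exists_hasSum_mul_comp_equiv U.ne_top
    (fun y : G => Equiv.mulLeft y⁻¹) (hpos f) (U.summable_size f) (lp.toNorm (T g))
  obtain ⟨H₂, hH₂, hs₂⟩ := lp.exists_hasSum_mul_comp_equiv U.ne_top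
    (fun y : G => Equiv.mulRight y⁻¹) (hpos g) (U.summable_size g) (lp.toNorm (T f))
  simp only [hT, hTn, Equiv.coe_mulLeft, Equiv.coe_mulRight] at hH₁ hs₁ hH₂ hs₂
  -- The substitution y ↦ y⁻¹x brings the average of right translates to the summation index of the
  -- convolution.
  have hs₂' : ∀ x, HasSum (fun y => ‖g.1 (y⁻¹ * x)‖ * ω (y⁻¹ * x) * U.toFun (y⁻¹ * x) *
      (‖f.1 y‖ * ω y)) (H₂ x) := fun x => by
    have := ((Equiv.inv G).trans (Equiv.mulRight x)).hasSum_iff.2 (hs₂ x)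
    simpa [Function.comp_def] using this
  have hb : ∀ x y, ‖f.1 y * g.1 (y⁻¹ * x)‖ * ω x ≤
      ‖f.1 y‖ * ω y * U.toFun y * (‖g.1 (y⁻¹ * x)‖ * ω (y⁻¹ * x)) +
      ‖g.1 (y⁻¹ * x)‖ * ω (y⁻¹ * x) * U.toFun (y⁻¹ * x) * (‖f.1 y‖ * ω y) := fun x y => by
    have h := U.map_mul_le y (y⁻¹ * x)
    rw [mul_inv_cancel_left] at h
    rw [norm_mul]
    refine (mul_le_mul_of_nonneg_left h (by positivity)).trans_eq ?_
    ring
  have hsum : ∀ x, Summable fun y => ‖f.1 y * g.1 (y⁻¹ * x)‖ * ω x := fun x =>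
    Summable.of_nonneg_of_le (fun y => mul_nonneg (norm_nonneg _) (ω.nonneg x)) (hb x)
      ((hs₁ x).add (hs₂' x)).summable
  have hsum' : ∀ x, Summable fun y => ‖f.1 y * g.1 (y⁻¹ * x)‖ := fun x =>
    (summable_mul_right_iff (ω.pos x).ne').1 (hsum x)
  have hle : ∀ x, ‖conv f.1 g.1 x * (ω x : ℂ)‖ ≤ ‖(H₁ + H₂) x‖ := fun x => by
    rw [norm_mul_weight]
    calc ‖conv f.1 g.1 x‖ * ω x ≤ (∑' y, ‖f.1 y * g.1 (y⁻¹ * x)‖) * ω x :=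
          mul_le_mul_of_nonneg_right (norm_tsum_le_tsum_norm (hsum' x)) (ω.nonneg x)
      _ = ∑' y, ‖f.1 y * g.1 (y⁻¹ * x)‖ * ω x := tsum_mul_right.symm
      _ ≤ H₁ x + H₂ x := hasSum_le (hb x) (hsum x).hasSum ((hs₁ x).add (hs₂' x))
      _ ≤ _ := Real.le_norm_self _
  have hmem : conv f.1 g.1 ∈ weightedLp p ω := (lp.memℓp (H₁ + H₂)).mono' hle
  refine ⟨fun x => (hsum' x).of_norm.hasSum, hmem, ?_⟩
  calc weightedNorm p ω ⟨conv f.1 g.1, hmem⟩ ≤ ‖H₁ + H₂‖ := lp.norm_mono U.ne_zero hle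
    _ ≤ ‖H₁‖ + ‖H₂‖ := norm_add_le _ _
    _ ≤ _ := add_le_add hH₁ (hH₂.trans_eq (mul_comm _ _))

end ControlFunction
end

/-! ### Inversion from a differential norm inequality -/

open Filter Topology in
/-- A nonnegative sequence with `x (n + 1) ≤ C * x n ^ (2 - θ) * (ρ ^ 2 ^ n) ^ θ` and `ρ < 1`
becomes small at an index depending only on the constants and on a bound for `x 0`. -/
theorem exists_index_le_half_of_superlinear {C θ ρ E : ℝ} (hθ : 0 < θ) (hθ' : θ < 1)
    (hρ0 : 0 ≤ ρ) (hρ : ρ < 1) :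
    ∃ k : ℕ, ∀ x : ℕ → ℝ, (∀ n, 0 ≤ x n) → x 0 ≤ E →
      (∀ n, x (n + 1) ≤ C * x n ^ (2 - θ) * (ρ ^ 2 ^ n) ^ θ) → x k ≤ 1 / 2 := by
  wlog hC : 1 ≤ C generalizing C
  · obtain ⟨k, hk⟩ := this (C := 1) le_rfl
    refine ⟨k, fun x h0 h1 h2 => hk x h0 h1 fun n => (h2 n).trans ?_⟩
    have := h0 n
    gcongr
    exact (not_le.1 hC).le
  wlog hρ2 : 0 < ρ generalizing ρ
  · obtain ⟨k, hk⟩ := this (ρ := 1 / 2) (by norm_num) (by norm_num) (by norm_num)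
    refine ⟨k, fun x h0 h1 h2 => hk x h0 h1 fun n => (h2 n).trans ?_⟩
    have := h0 n
    gcongr
    linarith
  have hα : 0 < 2 - θ := by linarith
  have h1θ : 0 < 1 - θ := by linarith
  -- Rescaling by D absorbs C, because D * C = D ^ (2 - θ).
  set D : ℝ := C ^ (1 / (1 - θ)) with hD
  have hD1 : 1 ≤ D := Real.one_le_rpow hC (by positivity)
  have hD0 : 0 < D := one_pos.trans_le hD1
  have hDC : D * C = D ^ (2 - θ) := by
    rw [show 2 - θ = 1 + (1 - θ) by ring, Real.rpow_add hD0, Real.rpow_one, hD,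
      ← Real.rpow_mul (by linarith), one_div_mul_cancel h1θ.ne', Real.rpow_one]
  -- W absorbs the initial value: D * x 0 ≤ ρ * W starts the induction in `key`.
  set W : ℝ := max 1 (D * E / ρ)
  have hW0 : 0 < W := one_pos.trans_le (le_max_left _ _)
  -- This is the bound of `key` in exponential form: ((2 - θ) / 2) ^ k tends to 0, so the negative
  -- log ρ decides the sign.
  have hlim : Tendsto (fun k : ℕ => Real.exp (2 ^ k * (Real.log ρ + ((2 - θ) / 2) ^ k * Real.log W)))
      atTop (𝓝 0) := by
    refine Real.tendsto_exp_atBot.comp ?_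
    refine (tendsto_pow_atTop_atTop_of_one_lt one_lt_two).atTop_mul_neg
      (Real.log_neg hρ2 hρ) ?_
    have h := tendsto_pow_atTop_nhds_zero_of_lt_one (r := (2 - θ) / 2) (by linarith) (by linarith)
    simpa using (h.mul_const (Real.log W)).const_add (Real.log ρ)
  obtain ⟨k, hk⟩ := (hlim.eventually_le_const (by norm_num : (0 : ℝ) < 1 / 2)).exists
  refine ⟨k, fun x h0 h1 h2 => ?_⟩
  have key : ∀ n, D * x n ≤ ρ ^ 2 ^ n * W ^ ((2 - θ) ^ n) := by
    intro n
    induction n with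
    | zero =>
      have h3 : D * E / ρ ≤ W := le_max_right _ _
      rw [div_le_iff₀ hρ2] at h3
      simp only [pow_zero, pow_one, Real.rpow_one]
      linarith [mul_le_mul_of_nonneg_left h1 hD0.le]
    | succ n ih =>
      have hx := h0 n
      calc D * x (n + 1) ≤ D * (C * x n ^ (2 - θ) * (ρ ^ 2 ^ n) ^ θ) := by
            gcongr; exact h2 n
        _ = (D * x n) ^ (2 - θ) * (ρ ^ 2 ^ n) ^ θ := by
            rw [Real.mul_rpow hD0.le hx, ← hDC]; ring
        _ ≤ (ρ ^ 2 ^ n * W ^ ((2 - θ) ^ n)) ^ (2 - θ) * (ρ ^ 2 ^ n) ^ θ := by gcongr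
        _ = ((ρ ^ 2 ^ n) ^ (2 - θ) * (ρ ^ 2 ^ n) ^ θ) * W ^ ((2 - θ) ^ (n + 1)) := by
            rw [Real.mul_rpow (by positivity) (by positivity), ← Real.rpow_mul hW0.le, pow_succ]
            ring
        _ = ρ ^ 2 ^ (n + 1) * W ^ ((2 - θ) ^ (n + 1)) := by
            rw [← Real.rpow_add (by positivity), sub_add_cancel, Real.rpow_two, ← pow_mul,
              pow_succ 2 n]
  refine le_trans ?_ hk
  have e : ρ ^ 2 ^ k = Real.exp (2 ^ k * Real.log ρ) := by
    have := Real.exp_log (pow_pos hρ2 (2 ^ k))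
    rw [Real.log_pow] at this
    exact_mod_cast this.symm
  calc x k ≤ D * x k := le_mul_of_one_le_left (h0 k) hD1
    _ ≤ _ := key k
    _ = _ := by
      rw [mul_add, ← mul_assoc, ← mul_pow, mul_div_cancel₀ _ two_ne_zero, Real.exp_add,
        Real.rpow_def_of_pos hW0, mul_comm (Real.log W), ← e]

/-- Conjugating v*v ≤ T by x gives 1 ≤ T x*x, while x*x ≤ R; so R⁻¹x*x lies between (RT)⁻¹ and 1. A
left inverse v suffices. -/
theorem norm_one_sub_smul_star_mul_self_le {B : Type*} [CStarAlgebra B] [PartialOrder B]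
    [StarOrderedRing B] {x v : B} {R T : ℝ} (hR : 0 < R) (hT : 0 < T) (hx : ‖x‖ ^ 2 ≤ R)
    (hv : v * x = 1) (hvT : ‖v‖ ^ 2 ≤ T) (hRT : 1 ≤ R * T) :
    ‖1 - R⁻¹ • (star x * x)‖ ≤ 1 - (R * T)⁻¹ := by
  have h1 : star x * x ≤ R • (1 : B) := by
    rw [← Algebra.algebraMap_eq_smul_one]
    exact CStarAlgebra.star_mul_le_algebraMap_norm_sq.trans (algebraMap_mono B hx)
  have h2 : (1 : B) ≤ T • (star x * x) := by
    have h3 : star v * v ≤ algebraMap ℝ B T :=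
      CStarAlgebra.star_mul_le_algebraMap_norm_sq.trans (algebraMap_mono B hvT)
    have h4 := star_left_conjugate_le_conjugate h3 x
    have e1 : star x * (star v * v) * x = 1 := by
      rw [mul_assoc, mul_assoc, hv, mul_one, ← star_mul, hv, star_one]
    have e2 : star x * algebraMap ℝ B T * x = T • (star x * x) := by
      rw [Algebra.algebraMap_eq_smul_one, mul_smul_comm, smul_mul_assoc, mul_one]
    rwa [e1, e2] at h4
  have h5 : R⁻¹ • (star x * x) ≤ 1 := by
    have := smul_le_smul_of_nonneg_left h1 (inv_nonneg.2 hR.le)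
    rwa [smul_smul, inv_mul_cancel₀ hR.ne', one_smul] at this
  have h6 : (R * T)⁻¹ • (1 : B) ≤ R⁻¹ • (star x * x) := by
    have := smul_le_smul_of_nonneg_left h2 (inv_nonneg.2 (mul_pos hR hT).le)
    rwa [smul_smul, mul_inv, mul_assoc, inv_mul_cancel₀ hT.ne', mul_one, ← mul_inv] at this
  rw [CStarAlgebra.norm_le_iff_le_algebraMap _ (sub_nonneg.2 (inv_le_one_of_one_le₀ hRT))
    (sub_nonneg.2 h5), map_sub, map_one, Algebra.algebraMap_eq_smul_one]
  exact sub_le_sub_left h6 1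

/-- A differential inequality for the norm of `A` with respect to the C*-norm of `B` bounds left
inverses in `A` by left inverses in `B`. -/
theorem exists_bound_leftInverse_of_differential {A B : Type*} [NormedRing A] [CompleteSpace A]
    [NormedAlgebra ℂ A] [StarRing A] [NormedStarGroup A] [CStarAlgebra B] [PartialOrder B]
    [StarOrderedRing B] (φ : A →⋆ₐ[ℂ] B) {c C θ : ℝ} (hφ : ∀ a, ‖φ a‖ ≤ c * ‖a‖)
    (hθ : 0 < θ) (hθ' : θ < 1) (hC0 : 0 ≤ C)
    (hC : ∀ a : A, ‖a * a‖ ≤ C * ‖a‖ ^ (2 - θ) * ‖φ a‖ ^ θ) (s t : ℝ) :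
    ∃ H : ℝ, 0 ≤ H ∧ ∀ a : A, ‖a‖ ≤ s → ∀ v : B, v * φ a = 1 → ‖v‖ ≤ t →
      ∃ a' : A, a' * a = 1 ∧ ‖a'‖ ≤ H := by
  -- R will bound ‖φ a‖² and T will bound ‖v‖². The added 1 gives R, T ≥ 1, hence 0 ≤ ρ < 1, and
  -- scaling by R⁻¹ does not increase norms.
  set R : ℝ := (|c| * |s|) ^ 2 + 1 with hR
  have hR1 : 1 ≤ R := by rw [hR]; nlinarith [sq_nonneg (|c| * |s|)]
  have hR0 : 0 < R := by linarith
  set T : ℝ := t ^ 2 + 1 with hT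
  have hT1 : 1 ≤ T := by rw [hT]; nlinarith [sq_nonneg t]
  have hRT : 1 ≤ R * T := one_le_mul_of_one_le_of_one_le hR1 hT1
  set ρ : ℝ := 1 - (R * T)⁻¹ with hρ
  have hρ0 : 0 ≤ ρ := sub_nonneg.2 (inv_le_one_of_one_le₀ hRT)
  have hρ1 : ρ < 1 := by have : 0 < (R * T)⁻¹ := by positivity
                         linarith
  set E : ℝ := ‖(1 : A)‖ + s ^ 2
  obtain ⟨k, hk⟩ := exists_index_le_half_of_superlinear (C := C) (E := E) hθ hθ' hρ0 hρ1
  refine ⟨(‖(1 : A)‖ + 1) * (∑ i ∈ Finset.range (2 ^ k), ‖(1 : A)‖ * E ^ i) * |s|,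
    by positivity, fun a ha v hv hvt => ?_⟩
  have hs : 0 ≤ s := (norm_nonneg a).trans ha
  set b : A := 1 - (R⁻¹ : ℂ) • (star a * a) with hb
  have haa : ‖star a * a‖ ≤ s ^ 2 := (norm_mul_le _ _).trans (by
    rw [norm_star, ← pow_two]; gcongr)
  have hRinv : ‖(R⁻¹ : ℂ)‖ ≤ 1 := by
    rw [norm_inv, Complex.norm_real, Real.norm_of_nonneg hR0.le]; exact inv_le_one_of_one_le₀ hR1
  have hbE : ‖b‖ ≤ E := (norm_sub_le _ _).trans (add_le_add_right ((norm_smul_le _ _).trans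
    ((mul_le_of_le_one_left (norm_nonneg _) hRinv).trans haa)) _)
  have hφb : ‖φ b‖ ≤ ρ := by
    have e : φ b = 1 - R⁻¹ • (star (φ a) * φ a) := by
      rw [hb, map_sub, map_one, map_smul, map_mul, map_star, ← Complex.ofReal_inv, Complex.coe_smul]
    rw [e]
    refine norm_one_sub_smul_star_mul_self_le hR0 (by linarith) ?_ hv ?_ hRT
    · have h1 : ‖φ a‖ ≤ |c| * |s| := (hφ a).trans (by
        rw [abs_of_nonneg hs]
        exact mul_le_mul (le_abs_self c) ha (norm_nonneg _) (abs_nonneg _))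
      have := pow_le_pow_left₀ (norm_nonneg _) h1 2
      linarith
    · have := pow_le_pow_left₀ (norm_nonneg _) hvt 2
      linarith
  have hsmall : ‖b ^ 2 ^ k‖ ≤ 1 / 2 := by
    refine hk (fun n => ‖b ^ 2 ^ n‖) (fun n => norm_nonneg _) (by simpa using hbE) fun n => ?_
    have h1 := hC (b ^ 2 ^ n)
    rw [← pow_add, ← two_mul, mul_comm 2, ← pow_succ] at h1
    refine h1.trans ?_
    have h2 : ‖φ (b ^ 2 ^ n)‖ ≤ ρ ^ 2 ^ n := by
      rw [map_pow]
      exact (norm_pow_le' _ (by positivity)).trans (pow_le_pow_left₀ (norm_nonneg _) hφb _)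
    gcongr
  have hlt : ‖b ^ 2 ^ k‖ < 1 := hsmall.trans_lt (by norm_num)
  set g : A := ∑' n : ℕ, (b ^ 2 ^ k) ^ n
  have hg : ‖g‖ ≤ ‖(1 : A)‖ + 1 := by
    refine (tsum_geometric_le_of_norm_lt_one _ hlt).trans ?_
    have : (1 - ‖b ^ 2 ^ k‖)⁻¹ ≤ 2 := by
      rw [inv_le_comm₀ (by linarith) two_pos]; linarith
    linarith
  have hg1 : g * (1 - b ^ 2 ^ k) = 1 := geom_series_mul_neg _ hlt
  set S : A := ∑ i ∈ Finset.range (2 ^ k), b ^ i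
  have hS : S * (1 - b) = 1 - b ^ 2 ^ k := geom_sum_mul_neg b _
  -- The factor ‖1‖ is kept because the norm of A need not satisfy ‖1‖ = 1.
  have hSn : ‖S‖ ≤ ∑ i ∈ Finset.range (2 ^ k), ‖(1 : A)‖ * E ^ i := by
    refine norm_sum_le_of_le _ fun i hi => ?_
    clear hi
    induction i with
    | zero => simp
    | succ i ih =>
      rw [pow_succ, pow_succ, ← mul_assoc]
      exact (norm_mul_le _ _).trans (mul_le_mul ih hbE (norm_nonneg _) (by positivity))
  -- By telescoping, g * S is a left inverse of 1 - b = R⁻¹a*a.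
  refine ⟨(R⁻¹ : ℂ) • (g * S * star a), ?_, ?_⟩
  · have e : (R⁻¹ : ℂ) • (star a * a) = 1 - b := by rw [hb, sub_sub_cancel]
    rw [smul_mul_assoc, mul_assoc, ← mul_smul_comm, e, mul_assoc, hS, hg1]
  · calc ‖(R⁻¹ : ℂ) • (g * S * star a)‖ ≤ ‖g * S * star a‖ :=
          (norm_smul_le _ _).trans (mul_le_of_le_one_left (norm_nonneg _) hRinv)
      _ ≤ ‖g‖ * ‖S‖ * ‖star a‖ := (norm_mul_le _ _).trans (by gcongr; exact norm_mul_le _ _)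
      _ ≤ _ := by
        rw [norm_star, abs_of_nonneg hs]
        gcongr

/-! ### Left convolution operators on ℓ²(G) -/

section LeftRegular

variable {G : Type u} [Group G]

@[simp]
theorem leftRegular_apply (g : G) (ξ : EllTwo G) (x : G) : leftRegular g ξ x = ξ (g⁻¹ * x) := rfl

theorem norm_leftRegular_le (g : G) : ‖leftRegular g‖ ≤ 1 :=
  LinearMap.mkContinuous_norm_le _ zero_le_one _

theorem leftRegular_mul (g h : G) : leftRegular (g * h) = leftRegular g * leftRegular h := by
  ext ξ x
  simp [mul_assoc]

theorem leftRegular_one : leftRegular (1 : G) = 1 := by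
  ext ξ x
  simp

theorem star_leftRegular (g : G) : star (leftRegular g) = leftRegular g⁻¹ := by
  symm
  refine (ContinuousLinearMap.eq_adjoint_iff _ _).2 fun ξ η => ?_
  rw [lp.inner_eq_tsum, lp.inner_eq_tsum]
  refine Eq.trans ?_ ((Equiv.mulLeft g).tsum_eq _)
  simp

/-- The operator `∑ f(y) λ(y)` of left convolution by `f`. -/
noncomputable def leftConv (f : G → ℂ) : EllTwo G →L[ℂ] EllTwo G := ∑' y, f y • leftRegular y

variable {f g : G → ℂ}

theorem norm_smul_leftRegular_le (f : G → ℂ) (y : G) : ‖f y • leftRegular y‖ ≤ ‖f y‖ :=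
  (norm_smul_le _ _).trans (mul_le_of_le_one_right (norm_nonneg _) (norm_leftRegular_le y))

theorem summable_norm_smul_leftRegular (hf : Summable fun x => ‖f x‖) :
    Summable fun y => ‖f y • leftRegular y‖ :=
  hf.of_nonneg_of_le (fun _ => norm_nonneg _) (norm_smul_leftRegular_le f)

theorem hasSum_leftConv (hf : Summable fun x => ‖f x‖) :
    HasSum (fun y => f y • leftRegular y) (leftConv f) :=
  (summable_norm_smul_leftRegular hf).of_norm.hasSum

theorem norm_leftConv_le (hf : Summable fun x => ‖f x‖) : ‖leftConv f‖ ≤ ∑' x, ‖f x‖ :=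
  (norm_tsum_le_tsum_norm (summable_norm_smul_leftRegular hf)).trans
    ((summable_norm_smul_leftRegular hf).tsum_le_tsum (norm_smul_leftRegular_le f) hf)

theorem hasSum_leftConv_apply (hf : Summable fun x => ‖f x‖) (ξ : EllTwo G) (x : G) :
    HasSum (fun y => f y * ξ (y⁻¹ * x)) (leftConv f ξ x) := by
  have h := (ContinuousLinearMap.apply ℂ (EllTwo G) ξ).hasSum (hasSum_leftConv hf)
  exact (lp.evalCLM ℂ (fun _ : G => ℂ) 2 x).hasSum h

theorem leftConv_apply_single (hf : Summable fun x => ‖f x‖) (x : G) :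
    let _ := Classical.decEq G
    leftConv f (lp.single 2 1 1) x = f x := by
  let _ := Classical.decEq G
  refine (hasSum_leftConv_apply hf _ x).unique ?_
  have h := hasSum_single (f := fun y => f y * (lp.single 2 (1 : G) (1 : ℂ) :
      EllTwo G) (y⁻¹ * x)) x fun y hy => by
    rw [lp.single_apply_ne, mul_zero]
    rwa [Ne, inv_mul_eq_one]
  simpa using h

/-- Evaluating at the unit vector δ_e returns f, so ‖f‖_∞ ≤ ‖f‖₂ ≤ ‖λ(f)‖. -/
theorem norm_apply_le_norm_leftConv (hf : Summable fun x => ‖f x‖) (x : G) :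
    ‖f x‖ ≤ ‖leftConv f‖ := by
  classical
  have h1 := leftConv_apply_single hf x
  have h2 : ‖(lp.single 2 (1 : G) (1 : ℂ) : EllTwo G)‖ = 1 := by
    rw [lp.norm_single (by norm_num), norm_one]
  have h3 := (leftConv f).le_opNorm (lp.single 2 (1 : G) (1 : ℂ))
  rw [h2, mul_one] at h3
  have h4 := lp.norm_apply_le_norm two_ne_zero (leftConv f (lp.single 2 (1 : G) (1 : ℂ))) x
  rw [← h1]
  convert h4.trans h3

theorem leftConv_inj (hf : Summable fun x => ‖f x‖) (hg : Summable fun x => ‖g x‖)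
    (h : leftConv f = leftConv g) : f = g := by
  funext x
  rw [← leftConv_apply_single hf, h, leftConv_apply_single hg]

theorem leftConv_conv (hf : Summable fun x => ‖f x‖) (hg : Summable fun x => ‖g x‖) :
    leftConv (ControlFunction.conv f g) = leftConv f * leftConv g := by
  have hF := summable_norm_smul_leftRegular hf
  have hG := summable_norm_smul_leftRegular hg
  -- The shear (x, y) ↦ (y, y⁻¹x) matches the iterated convolution sum with the double sum of the
  -- product.
  let σ : G × G ≃ G × G :=
    { toFun := fun z => (z.2, z.2⁻¹ * z.1)
      invFun := fun z => (z.1 * z.2, z.1)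
      left_inv := fun z => by simp
      right_inv := fun z => by simp }
  have hs := (summable_mul_of_summable_norm hF hG)
  have hs' := σ.summable_iff.2 hs
  have hc := σ.summable_iff.2 (summable_mul_of_summable_norm hf hg)
  have hterm : ∀ x y, f y • leftRegular y * g (y⁻¹ * x) • leftRegular (y⁻¹ * x) =
      (f y * g (y⁻¹ * x)) • leftRegular x := fun x y => by
    rw [smul_mul_smul_comm, ← leftRegular_mul, mul_inv_cancel_left]
  calc leftConv (ControlFunction.conv f g)
      = ∑' x, ∑' y, (f y * g (y⁻¹ * x)) • leftRegular x :=
        tsum_congr fun x => ((hc.prod_factor x).hasSum.smul_const _).tsum_eq.symm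
    _ = ∑' x, ∑' y, f y • leftRegular y * g (y⁻¹ * x) • leftRegular (y⁻¹ * x) := by
        simp only [hterm]
    _ = ∑' z : G × G, f (σ z).1 • leftRegular (σ z).1 * g (σ z).2 • leftRegular (σ z).2 :=
        (hs'.tsum_prod (f := fun z : G × G => _)).symm
    _ = ∑' z : G × G, f z.1 • leftRegular z.1 * g z.2 • leftRegular z.2 :=
        σ.tsum_eq (fun z : G × G => f z.1 • leftRegular z.1 * g z.2 • leftRegular z.2)
    _ = leftConv f * leftConv g := (tsum_mul_tsum_of_summable_norm hF hG).symm

theorem star_leftConv (f : G → ℂ) :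
    star (leftConv f) = leftConv fun x => (starRingEnd ℂ) (f x⁻¹) := by
  rw [leftConv, tsum_star, ← (Equiv.inv G).tsum_eq]
  simp [leftConv, star_leftRegular]

theorem leftConv_mem_reduced (hf : Summable fun x => ‖f x‖) :
    leftConv f ∈ reducedGroupCStarAlgebra G := by
  refine (StarSubalgebra.isClosed_topologicalClosure _).mem_of_tendsto (hasSum_leftConv hf)
    (.of_forall fun s => sum_mem fun y _ => ?_)
  exact SMulMemClass.smul_mem _ (StarSubalgebra.le_topologicalClosure _
    (StarAlgebra.subset_adjoin ℂ _ ⟨y, rfl⟩))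

end LeftRegular

/-! ### The Banach *-algebra and its representation -/

/-- The algebra `ℓ^p(G, ω)` under convolution. -/
def ConvAlg {G : Type u} [Group G] {p : ℝ≥0∞} {ω : Weight G} (_ : ControlFunction p ω) : Type u :=
  weightedLp p ω

namespace ConvAlg

open ControlFunction

variable {G : Type u} [Group G] {p : ℝ≥0∞} {ω : Weight G} {U : ControlFunction p ω}

noncomputable instance : AddCommGroup (ConvAlg U) := inferInstanceAs (AddCommGroup (weightedLp p ω))

noncomputable instance : Module ℂ (ConvAlg U) := inferInstanceAs (Module ℂ (weightedLp p ω))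

variable (U) in
/-- The identification of the algebra with the function space. -/
def toLp : ConvAlg U ≃ₗ[ℂ] weightedLp p ω := LinearEquiv.refl ℂ (weightedLp p ω)

theorem ext {a b : ConvAlg U} (h : ∀ x, (toLp U a).1 x = (toLp U b).1 x) : a = b :=
  Subtype.ext (funext h)

theorem summable (a : ConvAlg U) : Summable fun x => ‖(toLp U a).1 x‖ := U.summable_norm _

/-- Left convolution operators. -/
noncomputable def rep : ConvAlg U →ₗ[ℂ] EllTwo G →L[ℂ] EllTwo G where
  toFun a := leftConv (toLp U a).1
  map_add' a b := by
    refine ((hasSum_leftConv (summable (a + b))).unique ?_)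
    simpa [add_smul] using (hasSum_leftConv (summable a)).add (hasSum_leftConv (summable b))
  map_smul' c a := by
    refine ((hasSum_leftConv (summable (c • a))).unique ?_)
    simpa [smul_smul] using (hasSum_leftConv (summable a)).const_smul c

theorem rep_apply (a : ConvAlg U) : rep a = leftConv (toLp U a).1 := rfl

/-- Faithfulness lets the ring, algebra and star axioms be read off from the operator algebra. -/
theorem rep_injective : Function.Injective (rep (U := U)) := fun a b h =>
  ext fun x => congrFun (leftConv_inj (summable a) (summable b) h) x

noncomputable instance : Mul (ConvAlg U) :=
  ⟨fun a b => (toLp U).symm ⟨conv (toLp U a).1 (toLp U b).1, (U.conv_spec _ _).2.1⟩⟩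

theorem rep_mul (a b : ConvAlg U) : rep (a * b) = rep a * rep b :=
  leftConv_conv (summable a) (summable b)

open Classical in
theorem pi_single_mem (p : ℝ≥0∞) (ω : Weight G) : (Pi.single 1 1 : G → ℂ) ∈ weightedLp p ω := by
  have e : (fun x => (Pi.single 1 1 : G → ℂ) x * (ω x : ℂ)) = Pi.single 1 1 := by
    funext x
    by_cases hx : x = 1
    · subst hx; simp [ω.map_one]
    · simp [hx]
  show Memℓp (fun x => (Pi.single 1 1 : G → ℂ) x * (ω x : ℂ)) p
  rw [e, ← lp.coeFn_single (E := fun _ : G => ℂ)]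
  exact lp.memℓp _

open Classical in
noncomputable instance : One (ConvAlg U) := ⟨(toLp U).symm ⟨Pi.single 1 1, pi_single_mem p ω⟩⟩

open Classical in
theorem one_apply_one : (toLp U 1).1 1 = 1 :=
  Pi.single_eq_same (M := fun _ : G => ℂ) 1 1

open Classical in
theorem one_apply_of_ne {x : G} (hx : x ≠ 1) : (toLp U 1).1 x = 0 :=
  Pi.single_eq_of_ne (M := fun _ : G => ℂ) hx 1

theorem rep_one : rep (1 : ConvAlg U) = 1 := by
  refine (hasSum_leftConv (summable (1 : ConvAlg U))).unique ?_
  have h := hasSum_single (f := fun y => (toLp U 1).1 y • leftRegular y) 1 fun y hy => by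
    rw [one_apply_of_ne hy, zero_smul]
  simpa [one_apply_one, leftRegular_one] using h

noncomputable instance : Ring (ConvAlg U) :=
  { (inferInstance : AddCommGroup (ConvAlg U)) with
    mul_assoc := fun a b c => rep_injective (by simp only [rep_mul, mul_assoc])
    one_mul := fun a => rep_injective (by simp only [rep_mul, rep_one, one_mul])
    mul_one := fun a => rep_injective (by simp only [rep_mul, rep_one, mul_one])
    left_distrib := fun a b c => rep_injective (by simp only [rep_mul, map_add, mul_add])
    right_distrib := fun a b c => rep_injective (by simp only [rep_mul, map_add, add_mul])
    zero_mul := fun a => rep_injective (by simp only [rep_mul, map_zero, zero_mul])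
    mul_zero := fun a => rep_injective (by simp only [rep_mul, map_zero, mul_zero]) }

/-- Normalizing factor making the norm submultiplicative. -/
noncomputable def factor (U : ControlFunction p ω) : ℝ := 2 * U.const + 1

/-- In the factor, 2 * `U.const` pays for the two terms of the product estimate; the added 1 makes
the rescaled norm dominate the weighted norm. -/
theorem one_le_factor (U : ControlFunction p ω) : 1 ≤ factor U := by
  have := U.const_nonneg
  rw [factor]; linarith

theorem factor_pos (U : ControlFunction p ω) : 0 < factor U := one_pos.trans_le (one_le_factor U)

/-- The map `f ↦ K f ω` into `ℓ^p(G)`. -/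
noncomputable def toUnweighted (U : ControlFunction p ω) :
    ConvAlg U ≃ₗ[ℂ] lp (fun _ : G => ℂ) p where
  toFun a := ⟨fun x => (factor U : ℂ) * ((toLp U a).1 x * (ω x : ℂ)),
    (toLp U a).2.const_mul (factor U : ℂ)⟩
  map_add' a b := by
    ext x
    simp only [map_add, Submodule.coe_add, Pi.add_apply, add_mul, mul_add]
    rfl
  map_smul' c a := by
    ext x
    simp [mul_assoc, mul_left_comm]
  invFun F := (toLp U).symm ⟨fun x => (factor U : ℂ)⁻¹ * F x * (ω x : ℂ)⁻¹, by
    have h : Memℓp (fun x => (factor U : ℂ)⁻¹ * F x) p := (lp.memℓp F).const_mul _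
    have e : (fun x => (factor U : ℂ)⁻¹ * F x * (ω x : ℂ)⁻¹ * (ω x : ℂ)) =
        fun x => (factor U : ℂ)⁻¹ * F x := by
      funext x
      exact inv_mul_cancel_right₀ (Complex.ofReal_ne_zero.2 (ω.pos x).ne') _
    show Memℓp (fun x => (factor U : ℂ)⁻¹ * F x * (ω x : ℂ)⁻¹ * (ω x : ℂ)) p
    rw [e]; exact h⟩
  left_inv a := ext fun x => by
    have h1 : (factor U : ℂ) ≠ 0 := Complex.ofReal_ne_zero.2 (factor_pos U).ne'
    have h2 : (ω x : ℂ) ≠ 0 := Complex.ofReal_ne_zero.2 (ω.pos x).ne'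
    simp only [LinearEquiv.apply_symm_apply]
    field_simp
  right_inv F := by
    ext x
    have h1 : (factor U : ℂ) ≠ 0 := Complex.ofReal_ne_zero.2 (factor_pos U).ne'
    have h2 : (ω x : ℂ) ≠ 0 := Complex.ofReal_ne_zero.2 (ω.pos x).ne'
    simp only [LinearEquiv.apply_symm_apply]
    field_simp

theorem norm_toUnweighted (a : ConvAlg U) :
    ‖toUnweighted U a‖ = factor U * weightedNorm p ω (toLp U a) := by
  have e : toUnweighted U a = (factor U : ℂ) •
    (⟨fun x => (toLp U a).1 x * (ω x : ℂ), (toLp U a).2⟩ : lp (fun _ : G => ℂ) p) := rfl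
  rw [e, lp.norm_const_smul U.ne_zero, Complex.norm_real, Real.norm_of_nonneg (factor_pos U).le]
  rfl

theorem weightedNorm_mul_le (a b : ConvAlg U) :
    weightedNorm p ω (toLp U (a * b)) ≤ U.size (toLp U a) * weightedNorm p ω (toLp U b) +
      weightedNorm p ω (toLp U a) * U.size (toLp U b) :=
  (U.conv_spec (toLp U a) (toLp U b)).2.2

noncomputable instance : NormedAddCommGroup (ConvAlg U) :=
  have : Fact (1 ≤ p) := ⟨U.one_le⟩
  NormedAddCommGroup.induced (ConvAlg U) (lp (fun _ : G => ℂ) p) (toUnweighted U)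
    (toUnweighted U).injective

theorem norm_eq (a : ConvAlg U) : ‖a‖ = factor U * weightedNorm p ω (toLp U a) :=
  norm_toUnweighted a

theorem weightedNorm_le_norm (a : ConvAlg U) : weightedNorm p ω (toLp U a) ≤ ‖a‖ := by
  rw [norm_eq]
  exact le_mul_of_one_le_left (weightedNorm_nonneg _) (one_le_factor U)

theorem norm_mul_le (a b : ConvAlg U) : ‖a * b‖ ≤ ‖a‖ * ‖b‖ := by
  simp only [norm_eq]
  have ha := weightedNorm_nonneg (toLp U a)
  have hb := weightedNorm_nonneg (toLp U b)
  have h1 := mul_le_mul_of_nonneg_right (U.size_le (toLp U a)) hb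
  have h2 := mul_le_mul_of_nonneg_left (U.size_le (toLp U b)) ha
  have h3 : weightedNorm p ω (toLp U (a * b)) ≤
      factor U * (weightedNorm p ω (toLp U a) * weightedNorm p ω (toLp U b)) := by
    have := weightedNorm_mul_le a b
    rw [factor]
    nlinarith [mul_nonneg ha hb]
  calc _ ≤ factor U *
        (factor U * (weightedNorm p ω (toLp U a) * weightedNorm p ω (toLp U b))) :=
      mul_le_mul_of_nonneg_left h3 (factor_pos U).le
    _ = _ := by ring

noncomputable instance : NormedRing (ConvAlg U) :=
  { (inferInstance : NormedAddCommGroup (ConvAlg U)), (inferInstance : Ring (ConvAlg U)) with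
    norm_mul_le := norm_mul_le }

noncomputable instance : Algebra ℂ (ConvAlg U) :=
  Algebra.ofModule
    (fun c a b => rep_injective (by simp only [rep_mul, map_smul, smul_mul_assoc]))
    (fun c a b => rep_injective (by simp only [rep_mul, map_smul, mul_smul_comm]))

noncomputable instance : NormedAlgebra ℂ (ConvAlg U) where
  norm_smul_le c a := by
    refine le_of_eq ?_
    show ‖toUnweighted U (c • a)‖ = ‖c‖ * ‖toUnweighted U a‖
    rw [map_smul, lp.norm_const_smul U.ne_zero]

instance : CompleteSpace (ConvAlg U) := by
  have : Fact (1 ≤ p) := ⟨U.one_le⟩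
  have h : Isometry (toUnweighted U) :=
    AddMonoidHomClass.isometry_of_norm (toUnweighted U) fun a => rfl
  exact (IsometryEquiv.mk (toUnweighted U).toEquiv h).completeSpace

theorem star_spec (hp : 0 < p.toReal) (f : weightedLp p ω) :
    ∃ h : (fun x => (starRingEnd ℂ) (f.1 x⁻¹)) ∈ weightedLp p ω,
      weightedNorm p ω ⟨fun x => (starRingEnd ℂ) (f.1 x⁻¹), h⟩ ≤ weightedNorm p ω f := by
  let F : lp (fun _ : G => ℂ) p := ⟨fun x => f.1 x * (ω x : ℂ), f.2⟩
  let F' : lp (fun _ : G => ℂ) p := ⟨F ∘ Equiv.inv G, (lp.memℓp F).comp_equiv hp _⟩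
  have hle : ∀ x, ‖(starRingEnd ℂ) (f.1 x⁻¹) * (ω x : ℂ)‖ ≤ ‖F' x‖ := fun x => by
    refine le_of_eq ?_
    show _ = ‖f.1 x⁻¹ * (ω x⁻¹ : ℂ)‖
    rw [norm_mul_weight, norm_mul, RCLike.norm_conj, ω.map_inv, Complex.norm_real,
      Real.norm_of_nonneg (ω.nonneg x)]
  exact ⟨(lp.memℓp F').mono' hle, (lp.norm_mono (ENNReal.toReal_pos_iff.1 hp).1.ne' hle).trans_eq
    (lp.norm_comp_equiv hp (Equiv.inv G) F)⟩

noncomputable instance : Star (ConvAlg U) :=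
  ⟨fun a => (toLp U).symm ⟨_, (star_spec U.toReal_pos (toLp U a)).1⟩⟩

theorem star_apply (a : ConvAlg U) (x : G) :
    (toLp U (star a)).1 x = (starRingEnd ℂ) ((toLp U a).1 x⁻¹) := rfl

theorem rep_star (a : ConvAlg U) : rep (star a) = star (rep a) := (star_leftConv _).symm

noncomputable instance : StarRing (ConvAlg U) where
  star_involutive a := rep_injective (by simp only [rep_star, star_star])
  star_mul a b := rep_injective (by simp only [rep_star, rep_mul, star_mul])
  star_add a b := rep_injective (by simp only [rep_star, map_add, star_add])

instance : StarModule ℂ (ConvAlg U) :=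
  ⟨fun c a => rep_injective (by simp only [rep_star, map_smul, star_smul])⟩

instance : NormedStarGroup (ConvAlg U) where
  norm_star_le a := by
    rw [norm_eq, norm_eq]
    exact mul_le_mul_of_nonneg_left (star_spec U.toReal_pos (toLp U a)).2 (factor_pos U).le

variable (U) in
theorem isWeightedConvolutionAlgebra : IsWeightedConvolutionAlgebra p ω (toLp U) where
  norm_eq := ⟨factor U, factor_pos U, norm_eq⟩
  mul_apply a b := (U.conv_spec (toLp U a) (toLp U b)).1
  star_apply := star_apply
  one_apply_one := one_apply_one
  one_apply_of_ne _ := one_apply_of_ne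
  norm_star a := by
    have h := norm_star a
    rw [norm_eq, norm_eq] at h
    exact mul_left_cancel₀ (factor_pos U).ne' h

variable (U) in
/-- Left convolution as a *-representation. -/
noncomputable def repHom : ConvAlg U →⋆ₐ[ℂ] EllTwo G →L[ℂ] EllTwo G :=
  { AlgHom.ofLinearMap (rep (U := U)) rep_one rep_mul with
    map_star' := rep_star }

theorem norm_rep_le (a : ConvAlg U) : ‖rep a‖ ≤ U.δ⁻¹ * U.const * ‖a‖ := by
  have hs := U.summable_size (toLp U a)
  calc ‖rep a‖ ≤ ∑' x, ‖(toLp U a).1 x‖ := norm_leftConv_le (summable a)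
    _ ≤ ∑' x, U.δ⁻¹ * (‖(toLp U a).1 x‖ * ω x * U.toFun x) :=
        (summable a).tsum_le_tsum (U.norm_le_inv_mul (toLp U a)) (hs.mul_left _)
    _ = U.δ⁻¹ * U.size (toLp U a) := tsum_mul_left
    _ ≤ U.δ⁻¹ * (U.const * ‖a‖) := mul_le_mul_of_nonneg_left
        ((U.size_le _).trans (mul_le_mul_of_nonneg_left (weightedNorm_le_norm a) U.const_nonneg))
        (inv_nonneg.2 U.δ_pos.le)
    _ = _ := by ring

/-- The differential inequality: the product estimate with both factors equal, and the sup norm in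
the interpolation replaced by the operator norm. -/
theorem norm_mul_self_le (a : ConvAlg U) :
    ‖a * a‖ ≤ 2 * factor U * U.const * ‖a‖ ^ (2 - U.θ) * ‖rep a‖ ^ U.θ := by
  have hN := weightedNorm_nonneg (toLp U a)
  have hK := factor_pos U
  have hc := U.const_nonneg
  have h1 := (U.summable_size_and_le (toLp U a) (norm_apply_le_norm_leftConv (summable a))).2
  have h2 := weightedNorm_mul_le a a
  have hθ : 0 < 2 - U.θ := by linarith [U.θ_lt_one]
  have e : weightedNorm p ω (toLp U a) ^ (2 - U.θ) =
      weightedNorm p ω (toLp U a) ^ (1 - U.θ) * weightedNorm p ω (toLp U a) := by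
    rw [show 2 - U.θ = (1 - U.θ) + 1 by ring, Real.rpow_add_of_nonneg hN
      (by linarith [U.θ_lt_one]) zero_le_one, Real.rpow_one]
  rw [norm_eq (a * a)]
  calc factor U * weightedNorm p ω (toLp U (a * a))
      ≤ factor U * (2 * ((U.const * weightedNorm p ω (toLp U a) ^ (1 - U.θ) * ‖rep a‖ ^ U.θ) *
          weightedNorm p ω (toLp U a))) := by
        refine mul_le_mul_of_nonneg_left (h2.trans ?_) hK.le
        have := mul_le_mul_of_nonneg_right h1 hN
        rw [rep_apply]
        linarith
    _ = 2 * factor U * U.const * weightedNorm p ω (toLp U a) ^ (2 - U.θ) * ‖rep a‖ ^ U.θ := by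
        rw [e]; ring
    _ ≤ _ := by
        gcongr
        exact weightedNorm_le_norm a

variable (U) in
/-- Left convolution as a *-homomorphism into the reduced C*-algebra. -/
noncomputable def toReduced : ConvAlg U →⋆ₐ[ℂ] reducedGroupCStarAlgebra G :=
  (repHom U).codRestrict _ fun a => leftConv_mem_reduced (summable a)

theorem coe_toReduced (a : ConvAlg U) :
    (toReduced U a : EllTwo G →L[ℂ] EllTwo G) = rep a := rfl

theorem exists_inverse_bound (U : ControlFunction p ω) (s t : ℝ) :
    ∃ H : ℝ, 0 ≤ H ∧ ∀ a : ConvAlg U, weightedNorm p ω (toLp U a) ≤ s →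
      ∀ v : EllTwo G →L[ℂ] EllTwo G, v * rep a = 1 → ‖v‖ ≤ t →
        ∃ a' : ConvAlg U, a' * a = 1 ∧ weightedNorm p ω (toLp U a') ≤ H := by
  obtain ⟨H, hH, h⟩ := exists_bound_leftInverse_of_differential (repHom U) norm_rep_le
    U.θ_pos U.θ_lt_one
    (mul_nonneg (mul_nonneg zero_le_two (factor_pos U).le) U.const_nonneg) norm_mul_self_le
    (factor U * s) t
  refine ⟨H, hH, fun a ha v hv hvt => ?_⟩
  obtain ⟨a', h1, h2⟩ := h a ((norm_eq a).trans_le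
    (mul_le_mul_of_nonneg_left ha (factor_pos U).le)) v hv hvt
  exact ⟨a', h1, (weightedNorm_le_norm a').trans h2⟩

end ConvAlg

/-! ### Inverse-closedness and norm control -/

theorem ControlFunction.hasNormControlledInversionInReduced {G : Type u} [Group G] {p : ℝ≥0∞}
    {ω : Weight G} (U : ControlFunction p ω) : HasNormControlledInversionInReduced p ω := by
  refine ⟨ConvAlg U, inferInstance, inferInstance, inferInstance, inferInstance, inferInstance,
    inferInstance, ConvAlg.toLp U, ConvAlg.toReduced U, ConvAlg.isWeightedConvolutionAlgebra U,
    fun a b h => ConvAlg.rep_injective (congrArg Subtype.val h),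
    fun a ξ x => hasSum_leftConv_apply (ConvAlg.summable a) ξ x, fun a ha => ?_, ?_⟩
  · obtain ⟨v, hv⟩ := ha.exists_left_inv
    have hv' : (v : EllTwo G →L[ℂ] EllTwo G) * ConvAlg.rep a = 1 := congrArg Subtype.val hv
    obtain ⟨H, -, h⟩ := ConvAlg.exists_inverse_bound U _ _
    obtain ⟨a', h1, -⟩ := h a le_rfl v hv' le_rfl
    refine ⟨⟨a, a', ?_, h1⟩, rfl⟩
    refine ConvAlg.rep_injective ?_
    -- The left inverse is two-sided because its image is a left inverse of an invertible operator
    -- and the representation is faithful.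
    have hu : IsUnit (ConvAlg.rep a) := ha.map (reducedGroupCStarAlgebra G).subtype
    rw [ConvAlg.rep_mul, ConvAlg.rep_one]
    refine hu.mul_right_cancel ?_
    rw [mul_assoc, ← ConvAlg.rep_mul, h1, ConvAlg.rep_one, mul_one, one_mul]
  · choose H hH h using ConvAlg.exists_inverse_bound U
    refine ⟨H, fun s t _ _ => hH s t, fun a => ?_⟩
    obtain ⟨a', h1, h2⟩ := h _ _ (a : ConvAlg U) le_rfl
      (ConvAlg.toReduced U (↑a⁻¹ : ConvAlg U) : EllTwo G →L[ℂ] EllTwo G)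
      (by rw [ConvAlg.coe_toReduced, ← ConvAlg.rep_mul, Units.inv_mul, ConvAlg.rep_one]) le_rfl
    have : a' = ↑a⁻¹ := by
      rw [← mul_one a', ← a.mul_inv, ← mul_assoc, h1, one_mul]
    rwa [this] at h2

/-! ### Choice of exponents and the main theorem -/

/-- This is 1/s > 1/q = 1 - 1/p with denominators cleared, a form that also covers p = 1, q = ∞. -/
theorem mul_sub_one_lt_of_ofReal_lt {p q : ℝ≥0∞} (hp : 1 ≤ p) (hp_top : p ≠ ∞)
    (hpq : p⁻¹ + q⁻¹ = 1) {s : ℝ} (hs : 0 < s) (hsq : ENNReal.ofReal s < q) :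
    s * (p.toReal - 1) < p.toReal := by
  have hp0 : p ≠ 0 := (zero_lt_one.trans_le hp).ne'
  have hp' : 0 < p.toReal := ENNReal.toReal_pos hp0 hp_top
  have h1 : p⁻¹ = ENNReal.ofReal p.toReal⁻¹ := by
    rw [ENNReal.ofReal_inv_of_pos hp', ENNReal.ofReal_toReal hp_top]
  have h2 : q⁻¹ < ENNReal.ofReal s⁻¹ := by
    rw [ENNReal.ofReal_inv_of_pos hs]
    exact ENNReal.inv_lt_inv.2 hsq
  have h3 : (1 : ℝ≥0∞) < ENNReal.ofReal (p.toReal⁻¹ + s⁻¹) := by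
    rw [ENNReal.ofReal_add (by positivity) (by positivity), ← h1, ← hpq]
    exact ENNReal.add_lt_add_left (ENNReal.inv_ne_top.2 hp0) h2
  rw [ENNReal.one_lt_ofReal, inv_add_inv hp'.ne' hs.ne', one_lt_div (by positivity)] at h3
  linarith

/-- The conjugate of P/(1-θ) is t = P/(P-1+θ). For P > 1 it tends to q > s as θ → 0, while θt → 0,
so k = 1 works. For P = 1 one has θt = 1 always, and a power k ≥ 1/r is needed. -/
theorem exists_conjugate_exponents {P s r : ℝ} (hP : 1 ≤ P) (hs : 1 ≤ s) (hr : 0 < r)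
    (hsP : s * (P - 1) < P) :
    ∃ k θ t : ℝ, 1 ≤ k ∧ 0 < θ ∧ θ < 1 ∧ (P / (1 - θ)).HolderConjugate t ∧
      s * k ≤ t ∧ θ * t ≤ r * k := by
  have hconj : ∀ θ : ℝ, 0 < θ → θ < 1 → (P / (1 - θ)).HolderConjugate (P / (P - 1 + θ)) :=
    fun θ h0 h1 => by
      have h2 : 0 < 1 - θ := sub_pos.2 h1
      have h3 : 0 < P - 1 + θ := by linarith
      refine Real.holderConjugate_iff.2 ⟨?_, ?_⟩
      · rw [one_lt_div h2]; linarith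
      · rw [inv_div, inv_div]
        field_simp
        ring
  rcases hP.eq_or_lt with rfl | hP
  · have hk : 1 ≤ max 1 (1 / r) := le_max_left _ _
    have hr1 : 1 ≤ r * max 1 (1 / r) := by
      have := mul_le_mul_of_nonneg_left (le_max_right 1 (1 / r)) hr.le
      rwa [mul_one_div_cancel hr.ne'] at this
    have h0 : 0 < s * max 1 (1 / r) := by positivity
    have h1 : (s * max 1 (1 / r) + 1)⁻¹ < 1 := inv_lt_one_of_one_lt₀ (by linarith)
    refine ⟨max 1 (1 / r), (s * max 1 (1 / r) + 1)⁻¹, _, hk, by positivity, h1,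
      hconj _ (by positivity) h1, ?_, ?_⟩
    · rw [sub_self, zero_add, div_inv_eq_mul, one_mul]; linarith
    · rw [sub_self, zero_add, div_inv_eq_mul, one_mul, inv_mul_cancel₀ (by positivity)]
      exact hr1
  · have hP1 : 0 < P - 1 := sub_pos.2 hP
    have hs0 : 0 < s := by linarith
    -- The three bounds secure θ < 1, θt ≤ r and s ≤ t respectively.
    set θ := min (1 / 2) (min (r * (P - 1) / P) ((P - s * (P - 1)) / s)) with hθ
    have h0 : 0 < θ := lt_min (by norm_num)
      (lt_min (by positivity) (div_pos (sub_pos.2 hsP) hs0))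
    have h1 : θ ≤ 1 / 2 := min_le_left _ _
    have h2 : θ ≤ r * (P - 1) / P := (min_le_right _ _).trans (min_le_left _ _)
    have h3 : θ ≤ (P - s * (P - 1)) / s := (min_le_right _ _).trans (min_le_right _ _)
    rw [le_div_iff₀ (by linarith)] at h2 h3
    refine ⟨1, θ, _, le_rfl, h0, by linarith, hconj θ h0 (by linarith), ?_, ?_⟩
    · rw [mul_one, le_div_iff₀ (by linarith)]; linarith
    · rw [mul_one, ← mul_div_assoc, div_le_iff₀ (by linarith)]
      nlinarith

theorem Summable.rpow_of_one_le {ι : Type*} {f : ι → ℝ} (hf : Summable f) (h0 : ∀ i, 0 ≤ f i)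
    {k : ℝ} (hk : 1 ≤ k) : Summable fun i => f i ^ k := by
  refine hf.of_norm_bounded_eventually ?_
  filter_upwards [hf.tendsto_cofinite_zero.eventually_le_const one_pos] with i hi
  rw [Real.norm_of_nonneg (Real.rpow_nonneg (h0 i) _)]
  exact Real.rpow_le_self_of_le_one (h0 i) hi hk

/-- Since u is bounded, raising its exponent costs only a constant; since ω ≥ 1, lowering its
exponent is free. So (uω^θ)^t is dominated by a multiple of a k-th power of the given summand, after
replacing s by max s 1. -/
theorem exists_controlFunction {G : Type u} [Group G] {ω : Weight G} {p : ℝ≥0∞} (hp : 1 ≤ p)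
    (hp_top : p ≠ ∞) {u : G → ℝ} {s r M δ : ℝ} (hu0 : ∀ x, 0 ≤ u x) (huM : ∀ x, u x ≤ M)
    (hs : s * (p.toReal - 1) < p.toReal) (hr : 0 < r) (hδ : 0 < δ) (hδu : ∀ x, δ ≤ ω x * u x)
    (hω : ∀ x y, ω (x * y) / (ω x * ω y) ≤ u x + u y)
    (hsum : Summable fun x => u x ^ s * ω x ^ r) : Nonempty (ControlFunction p ω) := by
  have hP : 1 ≤ p.toReal := by simpa using ENNReal.toReal_mono hp_top hp
  have hu : ∀ x, 0 < u x := fun x => pos_of_mul_pos_right (hδ.trans_le (hδu x)) (ω.nonneg x)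
  have hM : 0 < M := (hu 1).trans_le (huM 1)
  have hraise : ∀ {a b : ℝ} (_ : a ≤ b) (x : G), u x ^ b ≤ M ^ (b - a) * u x ^ a :=
    fun {a b} hab x => by
      calc u x ^ b = u x ^ (b - a) * u x ^ a := by rw [← Real.rpow_add (hu x), sub_add_cancel]
        _ ≤ _ := mul_le_mul_of_nonneg_right
          (Real.rpow_le_rpow (hu0 x) (huM x) (sub_nonneg.2 hab)) (Real.rpow_nonneg (hu0 x) _)
  have hs' : max s 1 * (p.toReal - 1) < p.toReal := by
    rcases max_choice s 1 with h | h <;> rw [h]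
    · exact hs
    · linarith
  have hsum' : Summable fun x => u x ^ max s 1 * ω x ^ r := by
    refine (hsum.mul_left (M ^ (max s 1 - s))).of_nonneg_of_le (fun x => mul_nonneg
      (Real.rpow_nonneg (hu0 x) _) (Real.rpow_nonneg (ω.nonneg x) _)) fun x => ?_
    rw [← mul_assoc]
    exact mul_le_mul_of_nonneg_right (hraise (le_max_left _ _) x) (Real.rpow_nonneg (ω.nonneg x) _)
  obtain ⟨k, θ, t, hk, hθ0, hθ1, hconj, hkt, hrk⟩ :=
    exists_conjugate_exponents hP (le_max_right s 1) hr hs'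
  have hsumk := hsum'.rpow_of_one_le (fun x => mul_nonneg (Real.rpow_nonneg (hu0 x) _)
    (Real.rpow_nonneg (ω.nonneg x) _)) hk
  refine ⟨⟨u, θ, t, δ, hp, hp_top, hu0, hθ0, hθ1, hconj, hδ, hδu, fun x y => ?_, ?_⟩⟩
  · have := (div_le_iff₀ (mul_pos (ω.pos x) (ω.pos y))).1 (hω x y)
    linarith
  · refine (hsumk.mul_left (M ^ (t - max s 1 * k))).of_nonneg_of_le (fun x => Real.rpow_nonneg
      (mul_nonneg (hu0 x) (Real.rpow_nonneg (ω.nonneg x) _)) _) fun x => ?_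
    have hωx := ω.nonneg x
    rw [Real.mul_rpow (hu0 x) (by positivity), ← Real.rpow_mul hωx,
      Real.mul_rpow (Real.rpow_nonneg (hu0 x) _) (by positivity), ← Real.rpow_mul (hu0 x),
      ← Real.rpow_mul hωx, ← mul_assoc]
    exact mul_le_mul (hraise hkt x) (Real.rpow_le_rpow_of_exponent_le (ω.one_le x) hrk)
      (by positivity) (mul_nonneg (by positivity) (Real.rpow_nonneg (hu0 x) _))

theorem theorem4p1 {G : Type u} [Group G] (ω : Weight G) (p q : ℝ≥0∞) (hp : 1 ≤ p) (hp_top : p ≠ ∞)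
    (hpq : p⁻¹ + q⁻¹ = 1) :
    ((∃ (u : G → ℝ) (s r : ℝ),
        (∀ x, 0 ≤ u x) ∧ (∃ M : ℝ, ∀ x, u x ≤ M) ∧ ENNReal.ofReal s < q ∧ 0 < r ∧
        (∃ δ : ℝ, 0 < δ ∧ ∀ x, δ ≤ ω x * u x) ∧
        (∀ x y, ω (x * y) / (ω x * ω y) ≤ u x + u y) ∧
        Summable (fun x => u x ^ s * ω x ^ r)) →
      HasNormControlledInversionInReduced p ω) ∧
    (((∃ D : ℝ, 0 < D ∧ ∀ x y, ω (x * y) ≤ D * (ω x + ω y)) ∧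
        (∃ s : ℝ, 0 < s ∧ ENNReal.ofReal s < q ∧
          Memℓp (fun x => (ω x)⁻¹) (ENNReal.ofReal s))) →
      HasNormControlledInversionInReduced p ω) := by
  have hP : 1 ≤ p.toReal := by simpa using ENNReal.toReal_mono hp_top hp
  constructor
  · rintro ⟨u, s, r, hu0, ⟨M, huM⟩, hsq, hr, ⟨δ, hδ, hδu⟩, hω, hsum⟩
    have hs : s * (p.toReal - 1) < p.toReal := by
      rcases le_or_gt s 0 with h | h
      · nlinarith
      · exact mul_sub_one_lt_of_ofReal_lt hp hp_top hpq h hsq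
    obtain ⟨U⟩ := exists_controlFunction hp hp_top hu0 huM hs hr hδ hδu hω hsum
    exact U.hasNormControlledInversionInReduced
  · rintro ⟨⟨D, hD, hω⟩, s, hs0, hsq, hmem⟩
    have hs := mul_sub_one_lt_of_ofReal_lt hp hp_top hpq hs0 hsq
    -- With u = D/ω one has u^(s+r)ω^r = D^(s+r)ω^(-s). This r is small enough for s + r to stay
    -- below q.
    set r : ℝ := (p.toReal - s * (p.toReal - 1)) / (2 * p.toReal)
    have hr : 0 < r := div_pos (sub_pos.2 hs) (by linarith)
    have hrp : r * (2 * p.toReal) = p.toReal - s * (p.toReal - 1) :=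
      div_mul_cancel₀ _ (by linarith)
    have hsr : (s + r) * (p.toReal - 1) < p.toReal := by nlinarith
    have hsum : Summable fun x => (ω x)⁻¹ ^ s := by
      have h := (memℓp_gen_iff (by rwa [ENNReal.toReal_ofReal hs0.le])).1 hmem
      simpa [ENNReal.toReal_ofReal hs0.le, abs_of_pos (ω.pos _)] using h
    obtain ⟨U⟩ := exists_controlFunction (ω := ω) (u := fun x => D / ω x) (M := D) (δ := D) hp
      hp_top (fun x => div_nonneg hD.le (ω.nonneg x)) (fun x => div_le_self hD.le (ω.one_le x))
      hsr hr hD (fun x => (mul_div_cancel₀ D (ω.pos x).ne').ge)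
      (fun x y => by
        have hx := ω.pos x
        have hy := ω.pos y
        rw [div_le_iff₀ (mul_pos hx hy)]
        refine (hω x y).trans_eq ?_
        field_simp
        ring)
      ((hsum.mul_left (D ^ (s + r))).congr fun x => by
        have hx := ω.pos x
        rw [Real.div_rpow hD.le hx.le, Real.inv_rpow hx.le, Real.rpow_add hx]
        field_simp)
    exact U.hasNormControlledInversionInReduced
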